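/- All signals are real scalar sequences indexed by $\mathbb{Z}$. Let $\ell_2$ be the Hilbert space of square-summable signals, $\ell_2^{0+}$ the subspace of those vanishing at negative times, $(P_\tau u)_k=u_k$ for $k\le\tau$ and $0$ for $k>\tau$, $(S_\tau u)_k=u_{k-\tau}$, and $\ell_{2e}^{0+}=\{u:\ P_\tau u\in\ell_2^{0+}\ \forall \tau\ge 0\}$. A map $H:\ell_{2e}^{0+}\to\ell_{2e}^{0+}$ is causal if $P_\tau HP_\tau=P_\tau H$ for all $\tau\ge0$, time-invariant if $HS_\tau=S_\tau H$ for all integers $\tau\ge 0$, and bounded if $\sup\{\|P_\tau Hu\|/\|P_\tau u\|:\ \tau\in\mathbb{Z}^+,\ P_\tau u\ne0\}<\infty$. Let $\mathcal{S}$ be the set of all $\phi:\ell_{2e}^{0+}\to\ell_{2e}^{0+}$ of the form $(\phi v)_i=N(v_i)$, $i\ge 0$, where $N:\mathbb{R}\to\mathbb{R}$ is nondecreasing and $|N(x)|\le C|x|$ for all $x$ and some $C>0$ (depending on $\phi$). Let $\mathcal{S}_0\subset\mathcal{S}$ be the set of those for which $N$ is moreover Lipschitz continuous. Let $\Psi$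 be the set of all $\psi:\mathbb{R}\times\mathbb{Z}\to\mathbb{R}$ with $\psi(0,k)=0$, $\psi(x,k)x\ge0$, $|\psi(x,k)|\le C|x|$ and $|\psi(x,k)-\psi(y,k)|\le K|x-y|$ for all $x,y\in\mathbb{R}$, $k\in\mathbb{Z}$, with constants $C,K$ independent of $k$; $\psi(v,k)$ denotes the signal $k\mapsto\psi(v_k,k)$. Let $\mathcal{M}_{LTV}$ be the set of all bounded linear operators $M:\ell_2\to\ell_2$ whose matrix $(m_{ij})_{i,j\in\mathbb{Z}}$ satisfies: $m_{ij}\le0$ for $i\ne j$; every row and every column sums to zero; and for every $\epsilon>0$ there is $n\ge1$ such that in each row and in each column the sum of the $n$ entries with largest absolute values is at most $\epsilon$. The Lurye system $[G,\phi]$ is $v=Gw+e$, $w=\phi v$. It is well-posed if for every $e\in\ell_{2e}^{0+}$ there is a solution $(v,w)$ in $\ell_{2e}^{0+}$ depending causally on $e$. For a set $\mathcal{T}\subseteq\mathcal{S}$, $[G,\phi]$ is uniformly robustly stable over $\mathcal{T}$ if it is well-posed for all $\phi\in\mathcal{T}$ and there is $\gamma>0$ such that $\|P_\tau w\|/\|P_\tau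 e\|\le\gamma$ for all $\phi\in\mathcal{T}$, all $e,v,w\in\ell_{2e}^{0+}$ satisfying the equations of $[G,\phi]$, and all $\tau\in\mathbb{Z}^+$ with $P_\tau e\neq0$. **Theorem.** Let $G:\ell_{2e}^{0+}\to\ell_{2e}^{0+}$ be linear, time-invariant, causal and bounded. Let $\mathcal{T}\subseteq\mathcal{S}$ be any set of nonlinearities (for instance $\mathcal{T}=\mathcal{S}$) such that $[G,\phi]$ is well-posed for all $\phi\in\mathcal{T}$. Then $[G,\phi]$ is uniformly robustly stable over $\mathcal{T}$ if there exist $M\in\mathcal{M}_{LTV}$, $\psi\in\Psi$, $\phi_0\in\mathcal{S}_0$ and $\epsilon>0$ such that $$\langle M\phi_0Gw,w\rangle+\langle\psi(Gw,k),w\rangle\le-\epsilon\|w\|^2\qquad\text{for all } w\in\ell_2^{0+}.$$ -/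

import Mathlib

open scoped NNReal ENNReal

noncomputable section

namespace Lurye

/-! ## Signal spaces -/

/-- Two-sided, square-summable, real scalar signals, with the Hilbert space structure of Mathlib. -/
abbrev Ell2 : Type := lp (fun _ : ℤ => ℝ) 2

/-- The one-sided signals of `Ell2`: those vanishing at negative times. -/
def Ell2Plus : Submodule ℝ Ell2 where
  carrier := {f | ∀ i : ℤ, i < 0 → f i = 0}
  zero_mem' := by intro i _; simp
  add_mem' := by
    intro a b ha hb i hi
    simp [ha i hi, hb i hi]
  smul_mem' := by
    intro c a ha i hi
    simp [ha i hi]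

/-- Truncation of a signal after time `τ`. -/
def trunc (τ : ℤ) (u : ℤ → ℝ) : ℤ → ℝ := fun k => if k ≤ τ then u k else 0

/-- Rightward shift of a signal by `τ`. -/
def shift (τ : ℤ) (u : ℤ → ℝ) : ℤ → ℝ := fun k => u (k - τ)

theorem memℓp_trunc (τ : ℤ) {u : ℤ → ℝ} (hu : ∀ i : ℤ, i < 0 → u i = 0) :
    Memℓp (trunc τ u) 2 := by
  refine (memℓp_zero ?_).of_exponent_ge (by simp)
  refine (Set.finite_Icc (0 : ℤ) τ).subset ?_
  intro i hi
  replace hi : trunc τ u i ≠ 0 := hi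
  simp only [trunc, ne_eq, ite_eq_right_iff, Classical.not_imp] at hi
  refine ⟨?_, hi.1⟩
  by_contra h
  exact hi.2 (hu i (by omega))

/-- The one-sided extended space: all truncations at nonnegative times are one-sided
square-summable signals. -/
def Ell2e : Submodule ℝ (ℤ → ℝ) where
  carrier := {f | ∀ τ : ℤ, 0 ≤ τ →
    Memℓp (trunc τ f) 2 ∧ ∀ i : ℤ, i < 0 → trunc τ f i = 0}
  zero_mem' := by
    intro τ _
    exact ⟨memℓp_trunc τ (by simp), by simp [trunc]⟩
  add_mem' := by
    intro a b ha hb τ hτ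
    have h : trunc τ (a + b) = trunc τ a + trunc τ b := by
      funext k; simp only [trunc, Pi.add_apply]; split_ifs <;> simp
    rw [h]
    refine ⟨(ha τ hτ).1.add (hb τ hτ).1, fun i hi => ?_⟩
    simp [(ha τ hτ).2 i hi, (hb τ hτ).2 i hi]
  smul_mem' := by
    intro c a ha τ hτ
    have h : trunc τ (c • a) = c • trunc τ a := by
      funext k; simp only [trunc, Pi.smul_apply]; split_ifs <;> simp
    rw [h]
    refine ⟨(ha τ hτ).1.const_smul c, fun i hi => ?_⟩
    simp [(ha τ hτ).2 i hi]

theorem mem_Ell2e_iff {f : ℤ → ℝ} : f ∈ Ell2e ↔ ∀ i : ℤ, i < 0 → f i = 0 := by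
  constructor
  · intro h i hi
    have := (h 0 le_rfl).2 i hi
    simpa [trunc, hi.le] using this
  · intro h τ _
    refine ⟨memℓp_trunc τ h, fun i hi => ?_⟩
    simp [trunc, h i hi]

/-- The truncation `P τ`, from the extended space to one-sided square-summable signals. -/
def P (τ : ℤ) (u : Ell2e) : Ell2Plus :=
  ⟨⟨trunc τ u, memℓp_trunc τ (mem_Ell2e_iff.1 u.2)⟩, fun i hi => by
    simp [trunc, mem_Ell2e_iff.1 u.2 i hi]⟩

/-- The inclusion of the one-sided square-summable signals into the extended space. -/
def ofL2 (u : Ell2Plus) : Ell2e := ⟨fun k => (u : Ell2) k, mem_Ell2e_iff.2 u.2⟩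

/-- The shift by `τ ≥ 0` on the extended space. -/
def S (τ : ℕ) (u : Ell2e) : Ell2e :=
  ⟨shift τ u, mem_Ell2e_iff.2 fun i hi => mem_Ell2e_iff.1 u.2 _ (by omega)⟩

/-! ## Systems on the extended space -/

/-- Causality: `P_τ H P_τ = P_τ H` for all `τ ≥ 0`. -/
def IsCausal (H : Ell2e → Ell2e) : Prop :=
  ∀ τ : ℤ, 0 ≤ τ → ∀ u : Ell2e, P τ (H (ofL2 (P τ u))) = P τ (H u)

/-- Time invariance: `H S_τ = S_τ H` for all `τ ≥ 0`. -/
def IsTimeInvariant (H : Ell2e → Ell2e) : Prop :=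
  ∀ (τ : ℕ) (u : Ell2e), H (S τ u) = S τ (H u)

/-- Boundedness: the ratios `‖P_τ H u‖ / ‖P_τ u‖`, over `τ > 0` and `P_τ u ≠ 0`, are bounded. -/
def IsBoundedSystem (H : Ell2e → Ell2e) : Prop :=
  ∃ C : ℝ, ∀ τ : ℤ, 0 < τ → ∀ u : Ell2e, P τ u ≠ 0 → ‖P τ (H u)‖ / ‖P τ u‖ ≤ C

/-! ## Nonlinearities -/

/-- `N : ℝ → ℝ` realizes the memoryless nonlinearity `φ`. -/
def Realizes (N : ℝ → ℝ) (φ : Ell2e → Ell2e) : Prop :=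
  ∀ (v : Ell2e) (i : ℤ), 0 ≤ i → (φ v : ℤ → ℝ) i = N ((v : ℤ → ℝ) i)

/-- The set of all memoryless, bounded, monotone nonlinearities. -/
def MonotoneNonlinearities : Set (Ell2e → Ell2e) :=
  {φ | ∃ N : ℝ → ℝ, Realizes N φ ∧ (∃ C : ℝ, 0 < C ∧ ∀ x, |N x| ≤ C * |x|) ∧ Monotone N}

/-- The set of all memoryless, bounded, monotone, Lipschitz continuous nonlinearities. -/
def LipschitzMonotoneNonlinearities : Set (Ell2e → Ell2e) :=
  {φ | ∃ N : ℝ → ℝ, Realizes N φ ∧ (∃ C : ℝ, 0 < C ∧ ∀ x, |N x| ≤ C * |x|) ∧ Monotone N ∧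
    ∃ K : ℝ≥0, LipschitzWith K N}

/-- Bounded, memoryless, possibly time-varying, Lipschitz continuous nonlinearities `ψ(x,k)`
satisfying the sector condition. The gain and the Lipschitz constant are those of the operator
`v ↦ (ψ(v_k, k))_k`, hence uniform in `k`. -/
structure IsSectorMultiplier (ψ : ℝ → ℤ → ℝ) : Prop where
  bounded : ∃ C : ℝ, 0 < C ∧ ∀ x k, |ψ x k| ≤ C * |x|
  lipschitz : ∃ K : ℝ≥0, ∀ k, LipschitzWith K (fun x => ψ x k)
  sector : ∀ x k, 0 ≤ ψ x k * x
  map_zero : ∀ k, ψ 0 k = 0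

/-! ## The Lurye system -/

/-- The equations `v = G w + e`, `w = φ v` of the Lurye system `[G, φ]`. -/
def LuryeEq (G φ : Ell2e → Ell2e) (e v w : Ell2e) : Prop :=
  v = G w + e ∧ w = φ v

/-- `[G, φ]` is well-posed: for every `e` there is a solution `(v, w)`, depending causally
on `e`. -/
def WellPosed (G φ : Ell2e → Ell2e) : Prop :=
  ∃ V W : Ell2e → Ell2e, IsCausal V ∧ IsCausal W ∧ ∀ e, LuryeEq G φ e (V e) (W e)

/-- `[G, φ]` is uniformly robustly stable over the set `𝒯` of nonlinearities. -/
def UniformlyRobustlyStable (G : Ell2e → Ell2e) (𝒯 : Set (Ell2e → Ell2e)) : Prop :=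
  (∀ φ ∈ 𝒯, WellPosed G φ) ∧
  ∃ γ : ℝ, 0 < γ ∧ ∀ φ ∈ 𝒯, ∀ e v w : Ell2e, LuryeEq G φ e v w →
    ∀ τ : ℤ, 0 < τ → P τ e ≠ 0 → ‖P τ w‖ / ‖P τ e‖ ≤ γ

/-! ## Linear time-varying multipliers -/

/-- The entries of the doubly-infinite matrix of a bounded operator: `y_i = ∑ j, m_ij u_j`. -/
def entry (M : Ell2 →L[ℝ] Ell2) (i j : ℤ) : ℝ := M (lp.single 2 j (1 : ℝ)) i

/-- `F` is a set of `n` indices at which `|a|` takes its `n` largest values. -/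
def IsLargest (a : ℤ → ℝ) (n : ℕ) (F : Finset ℤ) : Prop :=
  F.card = n ∧ ∀ j ∈ F, ∀ l ∉ F, |a l| ≤ |a j|

/-- The class of linear time-varying multipliers: bounded operators whose matrix is doubly
hyperdominant with zero excess and such that for every `ε > 0` there is `n ≥ 1` for which, in each
row and in each column, the sum of the `n` entries of largest absolute value is at most `ε`. -/
structure IsLTVMultiplier (M : Ell2 →L[ℝ] Ell2) : Prop where
  offdiag : ∀ i j, i ≠ j → entry M i j ≤ 0
  col_sum : ∀ j, HasSum (fun i => entry M i j) 0
  row_sum : ∀ i, HasSum (fun j => entry M i j) 0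
  tail : ∀ ε : ℝ, 0 < ε → ∃ n : ℕ, 0 < n ∧
    (∀ i, ∀ F, IsLargest (fun j => entry M i j) n F → ∑ j ∈ F, entry M i j ≤ ε) ∧
    (∀ j, ∀ F, IsLargest (fun i => entry M i j) n F → ∑ i ∈ F, entry M i j ≤ ε)

/-! ## Restriction to square-summable signals -/

/-- The restriction of a system to one-sided square-summable signals, when it maps them to
square-summable signals. -/
def restrict (H : Ell2e → Ell2e) (h : ∀ u : Ell2Plus, Memℓp (H (ofL2 u) : ℤ → ℝ) 2)
    (u : Ell2Plus) : Ell2Plus :=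
  ⟨⟨(H (ofL2 u) : ℤ → ℝ), h u⟩, mem_Ell2e_iff.1 (H (ofL2 u)).2⟩

theorem norm_sq_eq (f : Ell2) : ‖f‖ ^ 2 = ∑' k, (f k) ^ 2 := by
  have := lp.norm_rpow_eq_tsum (p := 2) (by simp) f
  simpa using this

theorem summable_sq (f : Ell2) : Summable fun k => (f k) ^ 2 := by
  have := (lp.memℓp f).summable (by simp)
  simpa using this

theorem norm_P_ofL2_le (τ : ℤ) (u : Ell2Plus) : ‖P τ (ofL2 u)‖ ≤ ‖u‖ := by
  change ‖((P τ (ofL2 u) : Ell2Plus) : Ell2)‖ ≤ ‖(u : Ell2)‖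
  refine le_of_sq_le_sq ?_ (norm_nonneg _)
  rw [norm_sq_eq, norm_sq_eq]
  refine (summable_sq _).tsum_le_tsum (fun k => ?_) (summable_sq _)
  change (trunc τ (fun k => (u : Ell2) k) k) ^ 2 ≤ _
  unfold trunc
  split_ifs
  · exact le_rfl
  · simpa using sq_nonneg _

/-- A bounded linear system maps square-summable signals to square-summable signals. -/
theorem memℓp_of_bounded {G : Ell2e →ₗ[ℝ] Ell2e} (hG : IsBoundedSystem G) (u : Ell2Plus) :
    Memℓp (G (ofL2 u) : ℤ → ℝ) 2 := by
  obtain ⟨C, hC⟩ := hG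
  by_cases hu : u = 0
  · subst hu
    have : ofL2 0 = 0 := by ext k; simp [ofL2]
    rw [this, map_zero]
    exact zero_memℓp
  obtain ⟨k₀, hk₀⟩ : ∃ k, (u : Ell2) k ≠ 0 := by
    by_contra! h
    exact hu (by ext k; simpa using h k)
  refine memℓp_gen' (C := (|C| * ‖u‖) ^ 2) fun s => ?_
  obtain ⟨b, hb⟩ := s.bddAbove
  set τ : ℤ := max (max b k₀) 1
  have hτ : 0 < τ := lt_of_lt_of_le one_pos (le_max_right _ _)
  have hne : P τ (ofL2 u) ≠ 0 := by
    intro h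
    have h1 : ((P τ (ofL2 u) : Ell2Plus) : Ell2) k₀ = 0 := by rw [h]; simp
    have h2 : k₀ ≤ τ := (le_max_right _ _).trans (le_max_left _ _)
    apply hk₀
    simpa [P, trunc, ofL2, h2] using h1
  have h1 := hC τ hτ _ hne
  rw [div_le_iff₀ (norm_pos_iff.2 hne)] at h1
  have h2 : ‖P τ (G (ofL2 u))‖ ≤ |C| * ‖u‖ :=
    h1.trans (mul_le_mul (le_abs_self C) (norm_P_ofL2_le τ u) (norm_nonneg _) (abs_nonneg _))
  have h3 : ‖((P τ (G (ofL2 u)) : Ell2Plus) : Ell2)‖ ^ 2 ≤ (|C| * ‖u‖) ^ 2 :=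
    pow_le_pow_left₀ (norm_nonneg _) h2 2
  rw [norm_sq_eq] at h3
  refine le_trans ?_ ((summable_sq _).sum_le_tsum s (fun k _ => sq_nonneg _) |>.trans h3)
  refine Finset.sum_le_sum fun k hk => ?_
  have hkτ : k ≤ τ := (hb hk).trans ((le_max_left _ _).trans (le_max_left _ _))
  have : ((P τ (G (ofL2 u)) : Ell2Plus) : Ell2) k = (G (ofL2 u) : ℤ → ℝ) k := by
    simp [P, trunc, hkτ]
  rw [this]
  simp

theorem memℓp_of_le {f g : ℤ → ℝ} (hf : Memℓp f 2) {C : ℝ} (h : ∀ k, |g k| ≤ C * |f k|) :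
    Memℓp g 2 := by
  refine (memℓp_gen_iff (by simp)).2 ?_
  have h1 : Summable fun k => (C * |f k|) ^ 2 := by
    have := (hf.summable (by simp)).mul_left (C ^ 2)
    simpa [mul_pow] using this
  refine Summable.of_nonneg_of_le (fun k => by positivity) (fun k => ?_) h1
  have := pow_le_pow_left₀ (abs_nonneg (g k)) (h k) 2
  simpa using this

theorem memℓp_of_lipschitzMonotone {φ : Ell2e → Ell2e}
    (hφ : φ ∈ LipschitzMonotoneNonlinearities) (u : Ell2Plus) :
    Memℓp (φ (ofL2 u) : ℤ → ℝ) 2 := by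
  obtain ⟨N, hN, ⟨C, hC, hb⟩, -⟩ := hφ
  refine memℓp_of_le (lp.memℓp (u : Ell2)) (C := C) fun k => ?_
  by_cases hk : 0 ≤ k
  · rw [hN _ _ hk]; exact hb _
  · rw [mem_Ell2e_iff.1 (φ (ofL2 u)).2 k (by omega), abs_zero]
    positivity

/-- A bounded linear system as an operator on one-sided square-summable signals. -/
def linearL2 (G : Ell2e →ₗ[ℝ] Ell2e) (hG : IsBoundedSystem G) : Ell2Plus → Ell2Plus :=
  restrict G (memℓp_of_bounded hG)

/-- A Lipschitz monotone nonlinearity as an operator on one-sided square-summable signals. -/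
def monotoneL2 (φ : Ell2e → Ell2e) (hφ : φ ∈ LipschitzMonotoneNonlinearities) :
    Ell2Plus → Ell2Plus :=
  restrict φ (memℓp_of_lipschitzMonotone hφ)

/-- The operator `v ↦ (ψ(v_k, k))_k` on one-sided square-summable signals. -/
def sectorL2 (ψ : ℝ → ℤ → ℝ) (hψ : IsSectorMultiplier ψ) (v : Ell2Plus) : Ell2Plus :=
  ⟨⟨fun k => ψ ((v : Ell2) k) k, by
    obtain ⟨C, -, hb⟩ := hψ.bounded
    exact memℓp_of_le (lp.memℓp (v : Ell2)) (C := C) fun k => hb _ _⟩, fun i hi => by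
    change ψ ((v : Ell2) i) i = 0
    rw [v.2 i hi, hψ.map_zero]⟩

end Lurye

end

/-!
The bound on square-summable signals is direct. A loop solution has `w k = N (v k)` with
`v = G w + e`, so `φ₀ v` and `w` are monotone functions of the same signal `v`; hence
`⟨M φ₀ v, w⟩ ≥ 0` (`exists_potential`, `inner_multiplier_nonneg`), and `⟨ψ(v, k), w⟩ ≥ 0` by the
sector condition. Comparing with the multiplier condition, which has `G w = v - e` in place of `v`,
the Lipschitz constants of `φ₀` and `ψ` give `‖w‖ ≤ γ ‖e‖` with a constant `γ` that serves all
monotone nonlinearities, whatever their gain (`exists_l2_gain`).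

It remains to show that solutions for square-summable inputs are square-summable. This is a
homotopy through the loops with nonlinearity `s N`, `0 ≤ s ≤ 1`: `γ` is independent of `s`, so the
step length is too (`exists_homotopy_step`, `norm_P_le_of_homotopy`). The step replaces a solution
up to time `τ` by a full solution for the truncated input. By causality and time invariance this
amounts to solving, at each later time, a scalar equation `x - g * (s * N x) = y`, where `g` is the
feedthrough of `G`, the response at time `0` to the unit pulse at time `0`
(`exists_continuation`).

Well-posedness gives the solvability of the scalar equation for `s = 1` only
(`surjective_of_wellPosed`). For `g ≤ 0` it then holds for every `s ≥ 0` (`surjective_sub_mul`),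
and the multiplier condition does force `g ≤ 0`: if `g > 0`, the same homotopy applied to the linear
nonlinearities `k x` with `k < 1 / g` bounds `k / (1 - k * g)` by `γ`, which fails as `k` approaches
`1 / g` (`feedthrough_nonpos`).
-/

namespace Lurye

variable {G : Ell2e →ₗ[ℝ] Ell2e}

/-! ### Positivity of multipliers on pairs of monotone functions of a signal -/

open MeasureTheory in
/-- Two monotone functions `N` and `N₀` admit a common potential `F`, such that `N a` is a
subgradient at `N₀ a` of `F` as a function of `N₀`. It is the Stieltjes integral of `N` against
`N₀` from `0`. -/
theorem exists_potential {N N₀ : ℝ → ℝ} (hN : Monotone N) (hN₀ : Monotone N₀)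
    (hc : Continuous N₀) (h0 : N 0 = 0) :
    ∃ F : ℝ → ℝ, (∀ a b, N a * (N₀ b - N₀ a) ≤ F b - F a) ∧ F 0 = 0 ∧ ∀ b, 0 ≤ F b := by
  let f : StieltjesFunction ℝ := ⟨N₀, hN₀, fun x => hc.continuousWithinAt⟩
  have hint : ∀ a b, IntervalIntegrable N f.measure a b := fun a b => hN.intervalIntegrable
  have hconst : ∀ a b c : ℝ, a ≤ b → ∫ _ in a..b, c ∂f.measure = c * (N₀ b - N₀ a) := by
    intro a b c hab
    rw [intervalIntegral.integral_of_le hab, setIntegral_const, measureReal_def,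
      StieltjesFunction.measure_Ioc, ENNReal.toReal_ofReal, smul_eq_mul, mul_comm]
    exact sub_nonneg.2 (hN₀ hab)
  have key : ∀ a b, N a * (N₀ b - N₀ a) ≤
      (∫ t in (0 : ℝ)..b, N t ∂f.measure) - ∫ t in (0 : ℝ)..a, N t ∂f.measure := by
    intro a b
    rw [intervalIntegral.integral_interval_sub_left (hint _ _) (hint _ _)]
    rcases le_total a b with hab | hab
    · rw [← hconst a b _ hab]
      exact intervalIntegral.integral_mono_on hab (by simp) (hint _ _)
        fun t ht => hN ht.1
    · rw [intervalIntegral.integral_symm]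
      have h1 : ∫ t in b..a, N t ∂f.measure ≤ ∫ _ in b..a, N a ∂f.measure :=
        intervalIntegral.integral_mono_on hab (hint _ _) (by simp) fun t ht => hN ht.2
      rw [hconst b a _ hab] at h1
      linarith
  refine ⟨fun b => ∫ t in (0 : ℝ)..b, N t ∂f.measure, key, by simp, fun b => ?_⟩
  simpa [h0] using key 0 b

theorem hasSum_entry_mul (M : Ell2 →L[ℝ] Ell2) (x : Ell2) (i : ℤ) :
    HasSum (fun j => entry M i j * x j) (M x i) := by
  have h1 := (lp.hasSum_single (p := 2) (by simp) x).mapL M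
  have h2 := h1.mapL (lp.evalCLM ℝ (fun _ : ℤ => ℝ) 2 i)
  refine h2.congr_fun fun j => ?_
  have : lp.single 2 j (x j) = x j • (lp.single 2 j (1 : ℝ) : Ell2) := by
    rw [← lp.single_smul]; simp
  rw [this, map_smul, map_smul, smul_eq_mul, mul_comm]
  rfl

/-- A doubly hyperdominant operator with zero excess is nonnegative on a pair of sequences related
by a subgradient inequality: since the row sums vanish and the off-diagonal entries are
nonpositive, `inner (M x) y` is at least `∑ i, ∑ j, entry M i j * F j`, which vanishes on
exchanging the summations because the column sums do. -/
theorem inner_multiplier_nonneg {M : Ell2 →L[ℝ] Ell2}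
    (hoff : ∀ i j, i ≠ j → entry M i j ≤ 0)
    (hcol : ∀ j, HasSum (fun i => entry M i j) 0) (hrow : ∀ i, HasSum (fun j => entry M i j) 0)
    {x y : Ell2} {F : ℤ → ℝ} (hF : Summable F) (hxy : ∀ i j, y i * (x j - x i) ≤ F j - F i) :
    0 ≤ inner ℝ (M x) y := by
  have hdiag : ∀ j, entry M j j ≤ ‖M‖ := by
    intro j
    have h1 : |entry M j j| ≤ ‖M (lp.single 2 j (1 : ℝ))‖ :=
      lp.norm_apply_le_norm (by simp) (M (lp.single 2 j (1 : ℝ))) j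
    have h2 := M.le_opNorm (lp.single 2 j (1 : ℝ))
    rw [lp.norm_single (by simp), norm_one, mul_one] at h2
    exact (le_abs_self _).trans (h1.trans h2)
  -- As the column sums vanish, the absolute values in a column sum to twice the diagonal entry.
  have habs : ∀ j, HasSum (fun i => |entry M i j|) (2 * entry M j j) := by
    intro j
    have h1 := (hasSum_ite_eq j (2 * entry M j j)).sub (hcol j)
    rw [sub_zero] at h1
    refine h1.congr_fun ?_
    intro i
    split_ifs with h
    · subst h
      have : 0 ≤ entry M i i := by
        have h3 := (hasSum_ite_eq i (entry M i i)).sub (hcol i)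
        rw [sub_zero] at h3
        refine h3.nonneg fun k => ?_
        split_ifs with hk
        · subst hk; simp
        · simpa using hoff k i hk
      rw [abs_of_nonneg this]; ring
    · rw [abs_of_nonpos (hoff i j h)]; ring
  have hsum : Summable fun p : ℤ × ℤ => entry M p.2 p.1 * F p.1 := by
    refine Summable.of_norm ?_
    refine (summable_prod_of_nonneg fun _ => norm_nonneg _).2 ⟨fun j => ?_, ?_⟩
    · simpa [abs_mul] using (habs j).summable.mul_right |F j|
    · have h2 : ∀ j, ∑' i, ‖entry M i j * F j‖ = 2 * entry M j j * |F j| := by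
        intro j
        simp only [norm_mul, Real.norm_eq_abs]
        rw [tsum_mul_right, (habs j).tsum_eq]
      simp only [h2]
      refine Summable.of_nonneg_of_le (fun j => ?_) (fun j => ?_)
        ((hF.abs).mul_left (2 * ‖M‖))
      · rw [← h2]; exact tsum_nonneg fun _ => norm_nonneg _
      · have := hdiag j
        gcongr
  have hcomm : HasSum (fun i => ∑' j, entry M i j * F j) 0 := by
    have h1 : HasSum (fun p : ℤ × ℤ => entry M p.2 p.1 * F p.1) 0 := by
      have h2 := hsum.hasSum.prod_fiberwise fun j =>
        (hsum.prod_factor j).hasSum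
      have h3 : ∀ j, ∑' i, entry M i j * F j = 0 := by
        intro j; rw [tsum_mul_right, (hcol j).tsum_eq, zero_mul]
      simp only [h3] at h2
      rw [← h2.unique hasSum_zero]; exact hsum.hasSum
    have h4 := (Equiv.prodComm ℤ ℤ).hasSum_iff.2 h1
    exact h4.prod_fiberwise fun i => (h4.summable.prod_factor i).hasSum
  have hinner : HasSum (fun i => M x i * y i) (inner ℝ (M x) y) := by
    simpa [mul_comm] using lp.hasSum_inner (𝕜 := ℝ) (M x) y
  refine hasSum_le (fun i => ?_) hcomm hinner
  have hFi : Summable fun j => entry M i j * F j :=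
    ((Equiv.prodComm ℤ ℤ).summable_iff.2 hsum).prod_factor i
  have h1 : HasSum (fun j => entry M i j * (F j - F i)) (∑' j, entry M i j * F j) := by
    simpa [mul_sub] using hFi.hasSum.sub ((hrow i).mul_right (F i))
  have h2 : HasSum (fun j => entry M i j * (x j - x i) * y i) (M x i * y i) := by
    have := ((hasSum_entry_mul M x i).sub ((hrow i).mul_right (x i))).mul_right (y i)
    simpa [mul_sub] using this
  refine hasSum_le (fun j => ?_) h1 h2
  rcases eq_or_ne i j with rfl | hij
  · simp
  · have := mul_le_mul_of_nonpos_left (hxy i j) (hoff i j hij)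
    linarith

/-! ### Truncations and norms -/

theorem P_apply (τ : ℤ) (u : Ell2e) (k : ℤ) :
    ((P τ u : Ell2Plus) : Ell2) k = if k ≤ τ then u.1 k else 0 := rfl

theorem P_add (τ : ℤ) (u u' : Ell2e) : P τ (u + u') = P τ u + P τ u' := by
  ext k
  simp only [Submodule.coe_add, lp.coeFn_add, Pi.add_apply, P_apply]
  split_ifs <;> simp

theorem P_eq_iff {τ : ℤ} {u u' : Ell2e} : P τ u = P τ u' ↔ ∀ k ≤ τ, u.1 k = u'.1 k := by
  constructor
  · intro h k hk
    have : ((P τ u : Ell2Plus) : Ell2) k = ((P τ u' : Ell2Plus) : Ell2) k := by rw [h]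
    simpa [P_apply, hk] using this
  · intro h
    ext k
    simp only [P_apply]
    split_ifs with hk
    · exact h k hk
    · rfl

theorem norm_le_of_abs_le {f g : Ell2} {C : ℝ} (hC : 0 ≤ C) (h : ∀ k, |g k| ≤ C * |f k|) :
    ‖g‖ ≤ C * ‖f‖ := by
  refine le_of_sq_le_sq ?_ (by positivity)
  rw [mul_pow, norm_sq_eq, norm_sq_eq, ← tsum_mul_left]
  refine (summable_sq g).tsum_le_tsum (fun k => ?_) ((summable_sq f).mul_left _)
  have := pow_le_pow_left₀ (abs_nonneg _) (h k) 2
  simpa [mul_pow] using this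

theorem norm_P_le_of_abs_le {u u' : Ell2e} {C : ℝ} (hC : 0 ≤ C)
    (h : ∀ k, |u'.1 k| ≤ C * |u.1 k|) (τ : ℤ) : ‖P τ u'‖ ≤ C * ‖P τ u‖ := by
  change ‖((P τ u' : Ell2Plus) : Ell2)‖ ≤ C * ‖((P τ u : Ell2Plus) : Ell2)‖
  refine norm_le_of_abs_le hC fun k => ?_
  simp only [P_apply]
  split_ifs
  · exact h k
  · simp

theorem memℓp_of_norm_P_le {u : Ell2e} {B : ℝ} (h : ∀ τ : ℤ, 0 < τ → ‖P τ u‖ ≤ B) :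
    Memℓp u.1 2 := by
  refine memℓp_gen' (C := B ^ 2) fun s => ?_
  obtain ⟨b, hb⟩ := s.bddAbove
  have h3 : ‖((P (max b 1) u : Ell2Plus) : Ell2)‖ ^ 2 ≤ B ^ 2 :=
    pow_le_pow_left₀ (norm_nonneg _) (h _ (by simp)) 2
  rw [norm_sq_eq] at h3
  refine le_trans ?_ ((summable_sq _).sum_le_tsum s (fun k _ => sq_nonneg _) |>.trans h3)
  refine Finset.sum_le_sum fun k hk => ?_
  have hk' : k ≤ max b 1 := (hb hk).trans (le_max_left _ _)
  rw [P_apply, if_pos hk']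
  simp

/-! ### Causal time-invariant linear systems -/

/-- The unit pulse at the time `k ≥ 0`. -/
def pulse (k : ℕ) : Ell2e :=
  ⟨Pi.single (k : ℤ) 1, mem_Ell2e_iff.2 fun i hi => Pi.single_eq_of_ne (by omega) _⟩

/-- The response at time `0` of a system to the unit pulse at time `0`. -/
def feedthrough (G : Ell2e →ₗ[ℝ] Ell2e) : ℝ := (G (pulse 0)).1 0

theorem apply_eq_of_causal (hG : IsCausal G) {τ : ℤ} (hτ : 0 ≤ τ) {u u' : Ell2e}
    (h : ∀ k ≤ τ, u.1 k = u'.1 k) : ∀ k ≤ τ, (G u).1 k = (G u').1 k := by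
  rw [← P_eq_iff] at h ⊢
  rw [← hG τ hτ u, ← hG τ hτ u', h]

theorem apply_pulse (hG : IsTimeInvariant G) (k : ℕ) : (G (pulse k)).1 k = feedthrough G := by
  have h : pulse k = S k (pulse 0) := by
    ext i
    change (Pi.single (k : ℤ) (1 : ℝ) : ℤ → ℝ) i = (Pi.single ((0 : ℕ) : ℤ) (1 : ℝ) : ℤ → ℝ) (i - k)
    simp [Pi.single_apply, sub_eq_zero]
  rw [h, hG]
  simp [S, shift, feedthrough]

/-- By causality, the gain bound also holds for signals whose truncation vanishes, which
`IsBoundedSystem` leaves out. -/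
theorem exists_gain (hc : IsCausal G) (hb : IsBoundedSystem G) :
    ∃ Γ : ℝ, 0 < Γ ∧ ∀ τ : ℤ, 0 < τ → ∀ u, ‖P τ (G u)‖ ≤ Γ * ‖P τ u‖ := by
  obtain ⟨C, hC⟩ := hb
  refine ⟨|C| + 1, by positivity, fun τ hτ u => ?_⟩
  by_cases hu : P τ u = 0
  · have h0 : P τ u = P τ 0 := by
      rw [hu]; ext k; simp [P_apply]
    have : P τ (G u) = P τ (G 0) := by rw [← hc τ hτ.le u, ← hc τ hτ.le 0, h0]
    have hz : P τ (0 : Ell2e) = 0 := by rw [← h0, hu]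
    rw [this, map_zero, hz, norm_zero]
    positivity
  · have h1 := hC τ hτ u hu
    rw [div_le_iff₀ (norm_pos_iff.2 hu)] at h1
    refine h1.trans ?_
    gcongr
    linarith [le_abs_self C]

/-! ### Continuation of loop solutions -/

/-- The signals `v`, `w` solve the equations of the Lurye system with input `e` whose
nonlinearity acts by `N` at each time. For `N 0 = 0` the second equation is void at negative
times. -/
structure IsLoopSolution (G : Ell2e →ₗ[ℝ] Ell2e) (N : ℝ → ℝ) (e v w : Ell2e) : Prop where
  linear : v = G w + e
  memoryless : ∀ k, w.1 k = N (v.1 k)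

/-- The stages of the continuation past time `τ` of the signal `u`: the entry at time `τ + n + 1`
is the nonlinearity evaluated at the solution, given by `sol`, of the scalar loop equation. -/
def continuation (G : Ell2e →ₗ[ℝ] Ell2e) (N sol : ℝ → ℝ) (τ : ℕ) (u : Ell2e) : ℕ → Ell2e
  | 0 => ofL2 (P τ u)
  | n + 1 => continuation G N sol τ u n +
      N (sol ((G (continuation G N sol τ u n)).1 ((τ + n + 1 : ℕ) : ℤ))) • pulse (τ + n + 1)

theorem continuation_succ_apply (N sol : ℝ → ℝ) (τ : ℕ) (u : Ell2e) (n : ℕ) (k : ℤ) :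
    (continuation G N sol τ u (n + 1)).1 k = (continuation G N sol τ u n).1 k +
      if k = ((τ + n + 1 : ℕ) : ℤ) then
        N (sol ((G (continuation G N sol τ u n)).1 ((τ + n + 1 : ℕ) : ℤ))) else 0 := by
  simp [continuation, pulse, Pi.single_apply]

theorem continuation_apply_of_lt (N sol : ℝ → ℝ) (τ : ℕ) (u : Ell2e) (n : ℕ) {k : ℤ}
    (hk : (τ + n : ℤ) < k) : (continuation G N sol τ u n).1 k = 0 := by
  induction n with
  | zero =>
    have : ¬ k ≤ (τ : ℤ) := by push_cast at hk; omega
    simp [continuation, ofL2, P_apply, this]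
  | succ n ih =>
    push_cast at hk
    rw [continuation_succ_apply, ih (by omega), if_neg (by push_cast; omega), add_zero]

theorem continuation_add_apply (N sol : ℝ → ℝ) (τ : ℕ) (u : Ell2e) (n d : ℕ) {k : ℤ}
    (hk : k ≤ (τ + n : ℤ)) :
    (continuation G N sol τ u (n + d)).1 k = (continuation G N sol τ u n).1 k := by
  induction d with
  | zero => rfl
  | succ d ih =>
    rw [← add_assoc, continuation_succ_apply, ih, if_neg (by push_cast; omega), add_zero]

/-- A signal solving the loop equations up to time `τ` can be modified after time `τ` to a loop
solution for the truncated input: by causality and time invariance, each step of the continuation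
is the same scalar equation. -/
theorem exists_continuation (hc : IsCausal G) (hti : IsTimeInvariant G) {N : ℝ → ℝ}
    (hsurj : Function.Surjective fun x => x - feedthrough G * N x)
    {e w : Ell2e} {τ : ℕ} (h : ∀ k ≤ (τ : ℤ), w.1 k = N ((G w).1 k + e.1 k)) :
    ∃ v' w', IsLoopSolution G N (ofL2 (P τ e)) v' w' ∧ P τ w' = P τ w := by
  choose sol hsol using hsurj
  set W := continuation G N sol τ w with hW
  have hW0 : ∀ k ≤ (τ : ℤ), (W 0).1 k = w.1 k := fun k hk => by
    simp [hW, continuation, ofL2, P_apply, hk]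
  let w' : Ell2e := ⟨fun k => (W (k - τ).toNat).1 k, mem_Ell2e_iff.2 fun i hi =>
    mem_Ell2e_iff.1 (W (i - τ).toNat).2 i hi⟩
  have hw' : ∀ (n : ℕ) (k : ℤ), k ≤ (τ + n : ℤ) → w'.1 k = (W n).1 k := by
    intro n k hk
    obtain ⟨d, hd⟩ : ∃ d, n = (k - τ).toNat + d := Nat.exists_eq_add_of_le (by omega)
    change (W (k - τ).toNat).1 k = _
    rw [hd]
    exact (continuation_add_apply N sol τ w _ d (by omega)).symm
  have hww : ∀ k ≤ (τ : ℤ), w'.1 k = w.1 k := fun k hk => by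
    rw [hw' 0 k (by simpa using hk), hW0 k hk]
  refine ⟨G w' + ofL2 (P τ e), w', ⟨rfl, fun k => ?_⟩, P_eq_iff.2 hww⟩
  change _ = N ((G w').1 k + ((P τ e : Ell2Plus) : Ell2) k)
  rw [P_apply]
  by_cases hk : k ≤ (τ : ℤ)
  · rw [if_pos hk, apply_eq_of_causal hc (by omega) hww k hk, hww k hk, h k hk]
  · obtain ⟨n, rfl⟩ : ∃ n : ℕ, k = ((τ + n + 1 : ℕ) : ℤ) := ⟨(k - τ - 1).toNat, by omega⟩
    set y := (G (W n)).1 ((τ + n + 1 : ℕ) : ℤ) with hy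
    have h1 : w'.1 ((τ + n + 1 : ℕ) : ℤ) = N (sol y) := by
      rw [hw' (n + 1) _ (by push_cast; omega), hW, continuation_succ_apply,
        continuation_apply_of_lt _ _ _ _ _ (by push_cast; omega), if_pos rfl, zero_add]
    have h2 : (G w').1 ((τ + n + 1 : ℕ) : ℤ) = y + N (sol y) * feedthrough G := by
      rw [apply_eq_of_causal hc (by omega) (fun k hk => hw' (n + 1) k (by push_cast at hk ⊢; omega))
        _ le_rfl]
      simp only [hW, continuation, map_add, map_smul]
      rw [← apply_pulse hti (τ + n + 1)]
      rfl
    rw [if_neg hk, h1, h2, add_zero]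
    have := hsol y
    congr 1
    simp only at this
    linarith

/-! ### The a priori bound on square-summable solutions -/

theorem apply_zero_of_abs_le {N : ℝ → ℝ} {C : ℝ} (h : ∀ x, |N x| ≤ C * |x|) : N 0 = 0 := by
  simpa using h 0

/-- The a priori bound: on square-summable loop solutions the gain from `e` to `w` is bounded
uniformly over all monotone nonlinearities. With `v` in place of `G w`, both inner products of the
multiplier condition are nonnegative, and the replacement costs a multiple of `‖e‖ * ‖w‖`. -/
theorem exists_l2_gain (hbdd : IsBoundedSystem G)
    {M : Ell2 →L[ℝ] Ell2} (hM : IsLTVMultiplier M)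
    {ψ : ℝ → ℤ → ℝ} (hψ : IsSectorMultiplier ψ)
    {φ₀ : Ell2e → Ell2e} (hφ₀ : φ₀ ∈ LipschitzMonotoneNonlinearities) {ε : ℝ} (hε : 0 < ε)
    (hmult : ∀ w : Ell2Plus, inner ℝ (M (monotoneL2 φ₀ hφ₀ (linearL2 G hbdd w))) (w : Ell2)
      + inner ℝ (sectorL2 ψ hψ (linearL2 G hbdd w)) w ≤ -ε * ‖w‖ ^ 2) :
    ∃ γ : ℝ, 0 < γ ∧ ∀ (N : ℝ → ℝ) (C : ℝ), Monotone N → (∀ x, |N x| ≤ C * |x|) →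
      ∀ e v w : Ell2Plus, IsLoopSolution G N (ofL2 e) (ofL2 v) (ofL2 w) → ‖w‖ ≤ γ * ‖e‖ := by
  obtain ⟨N₀, hN₀, ⟨C₀, -, hC₀⟩, hmono₀, K₀, hK₀⟩ := id hφ₀
  obtain ⟨K, hK⟩ := hψ.lipschitz
  refine ⟨(‖M‖ * K₀ + K) / ε + 1, by positivity, fun N C hN hC e v w h => ?_⟩
  have h00 := apply_zero_of_abs_le hC₀
  have hz0 := apply_zero_of_abs_le hC
  set z := linearL2 G hbdd w with hz
  have hvz : ∀ k, (v : Ell2) k - (z : Ell2) k = (e : Ell2) k := by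
    intro k
    have : (ofL2 v).1 k = (G (ofL2 w) + ofL2 e).1 k := by rw [← h.linear]
    change (v : Ell2) k = (z : Ell2) k + (e : Ell2) k at this
    linarith
  have hwv : ∀ k, (w : Ell2) k = N ((v : Ell2) k) := h.memoryless
  have happ : ∀ (u : Ell2Plus) k, (monotoneL2 φ₀ hφ₀ u : Ell2) k = N₀ ((u : Ell2) k) := by
    intro u k
    rcases le_or_gt 0 k with hk | hk
    · exact hN₀ (ofL2 u) k hk
    · rw [(monotoneL2 φ₀ hφ₀ u).2 k hk, u.2 k hk, h00]
  have hX : 0 ≤ inner ℝ (M (monotoneL2 φ₀ hφ₀ v)) (w : Ell2) := by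
    obtain ⟨F, hF, hF0, hFnn⟩ := exists_potential hN hmono₀ hK₀.continuous hz0
    refine inner_multiplier_nonneg hM.offdiag hM.col_sum hM.row_sum
      (F := fun k => F ((v : Ell2) k)) ?_ fun i j => ?_
    -- The subgradient inequality between `v k` and `0` gives `F (v k) ≤ N (v k) * N₀ (v k)`.
    · refine Summable.of_nonneg_of_le (fun k => hFnn _) (fun k => ?_)
        (lp.summable_inner (𝕜 := ℝ) (monotoneL2 φ₀ hφ₀ v : Ell2) (w : Ell2))
      have := hF ((v : Ell2) k) 0
      rw [happ, hwv]
      simp only [h00, hF0, zero_sub] at this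
      simp only [RCLike.inner_apply, conj_trivial]
      linarith
    · rw [happ, happ, hwv]
      exact hF _ _
  have hY : 0 ≤ inner ℝ (sectorL2 ψ hψ v : Ell2) (w : Ell2) := by
    refine (lp.hasSum_inner (𝕜 := ℝ) (sectorL2 ψ hψ v : Ell2) (w : Ell2)).nonneg fun k => ?_
    simp only [RCLike.inner_apply, conj_trivial]
    rw [hwv]
    change 0 ≤ N ((v : Ell2) k) * ψ ((v : Ell2) k) k
    have hs := hψ.sector ((v : Ell2) k) k
    rcases lt_trichotomy ((v : Ell2) k) 0 with hk | hk | hk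
    · exact mul_nonneg_of_nonpos_of_nonpos (hz0 ▸ hN hk.le) (nonpos_of_mul_nonneg_left hs hk)
    · simp [hk, hz0]
    · exact mul_nonneg (hz0 ▸ hN hk.le) (nonneg_of_mul_nonneg_left hs hk)
  have hXd : ‖(monotoneL2 φ₀ hφ₀ v : Ell2) - monotoneL2 φ₀ hφ₀ z‖ ≤ K₀ * ‖e‖ := by
    refine norm_le_of_abs_le (f := (e : Ell2)) K₀.2 fun k => ?_
    rw [lp.coeFn_sub, Pi.sub_apply, happ, happ, ← hvz]
    exact hK₀.dist_le_mul _ _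
  have hYd : ‖(sectorL2 ψ hψ v : Ell2) - sectorL2 ψ hψ z‖ ≤ K * ‖e‖ := by
    refine norm_le_of_abs_le (f := (e : Ell2)) K.2 fun k => ?_
    rw [lp.coeFn_sub, Pi.sub_apply, ← hvz]
    exact (hK k).dist_le_mul _ _
  have h1 : inner ℝ (M (monotoneL2 φ₀ hφ₀ v)) (w : Ell2)
      - inner ℝ (M (monotoneL2 φ₀ hφ₀ z)) (w : Ell2) ≤ ‖M‖ * (K₀ * ‖e‖) * ‖w‖ := by
    rw [← inner_sub_left, ← map_sub]
    refine (real_inner_le_norm _ _).trans ?_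
    gcongr
    · refine (M.le_opNorm _).trans ?_
      gcongr
    · exact le_rfl
  have h2 : inner ℝ (sectorL2 ψ hψ v : Ell2) (w : Ell2)
      - inner ℝ (sectorL2 ψ hψ z : Ell2) (w : Ell2) ≤ K * ‖e‖ * ‖w‖ := by
    rw [← inner_sub_left]
    refine (real_inner_le_norm _ _).trans ?_
    gcongr
    exact le_rfl
  have h3 := hmult w
  rw [← hz] at h3
  change _ + inner ℝ (sectorL2 ψ hψ z : Ell2) (w : Ell2) ≤ _ at h3
  have h4 : ε * ‖w‖ * ‖w‖ ≤ (‖M‖ * K₀ + K) * ‖e‖ * ‖w‖ := by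
    linarith
  rcases (norm_nonneg w).eq_or_lt with h5 | h5
  · rw [← h5]; positivity
  · have h6 := le_of_mul_le_mul_right h4 h5
    have h7 : ‖w‖ ≤ (‖M‖ * K₀ + K) / ε * ‖e‖ := by
      rw [div_mul_eq_mul_div, le_div_iff₀ hε]; linarith
    linarith [norm_nonneg e]

/-! ### Homotopy in the nonlinearity -/

/-- The step of the homotopy: if the loop with `s * N` has gain `γ`, then so has the loop with
`t * N`, for `t - s` below a threshold that does not depend on `s`. A solution for `t * N` solves
the loop for `s * N` with an input perturbed by a small multiple of the solution itself. Hence the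
solution of the loop for `t * N` with a truncated input is square-summable, and the a priori bound
restores the constant `γ`. -/
theorem exists_homotopy_step (hc : IsCausal G) (hti : IsTimeInvariant G) (hb : IsBoundedSystem G)
    {γ : ℝ} (hγ : 0 < γ) {C : ℝ} (hC0 : 0 < C) :
    ∃ δ : ℝ, 0 < δ ∧ ∀ N : ℝ → ℝ, (∀ x, |N x| ≤ C * |x|) →
      ∀ s t : ℝ, s ≤ t → t ≤ s + δ →
      (∀ e v w : Ell2Plus, IsLoopSolution G (fun x => t * N x) (ofL2 e) (ofL2 v) (ofL2 w) →
        ‖w‖ ≤ γ * ‖e‖) →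
      (Function.Surjective fun x => x - feedthrough G * (t * N x)) →
      (∀ e v w, IsLoopSolution G (fun x => s * N x) e v w →
        ∀ τ : ℤ, 0 < τ → ‖P τ w‖ ≤ γ * ‖P τ e‖) →
      ∀ e v w, IsLoopSolution G (fun x => t * N x) e v w →
        ∀ τ : ℤ, 0 < τ → ‖P τ w‖ ≤ γ * ‖P τ e‖ := by
  obtain ⟨Γ, hΓ, hgain⟩ := exists_gain hc hb
  -- With this threshold the perturbation contributes at most half of `‖P T w'‖` in `hbound`.
  refine ⟨(2 * (C * (γ * Γ + 1) * Γ))⁻¹, by positivity, ?_⟩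
  intro N hN s t hst hts hl2 hsurj hs e v w h τ hτ
  obtain ⟨τ, rfl⟩ : ∃ n : ℕ, τ = n := ⟨τ.toNat, by omega⟩
  obtain ⟨v', w', h', hw'⟩ :=
    exists_continuation hc hti hsurj (e := e) (w := w) (τ := τ) fun k _ => by
      rw [h.memoryless k, h.linear]; rfl
  set e' : Ell2Plus := P τ e with he'
  have hN0 := apply_zero_of_abs_le hN
  -- `w' - d` is the output `s * N` of the loop, and `G d` is moved to the input.
  let d : Ell2e := ⟨fun k => (t - s) * N (v'.1 k), mem_Ell2e_iff.2 fun i hi => by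
    rw [mem_Ell2e_iff.1 v'.2 i hi, hN0, mul_zero]⟩
  have hsol : IsLoopSolution G (fun x => s * N x) (ofL2 e' + G d) v' (w' - d) := by
    refine ⟨?_, fun k => ?_⟩
    · rw [map_sub, h'.linear]; abel
    · change w'.1 k - (t - s) * N (v'.1 k) = _
      rw [h'.memoryless]; ring
  have hbound : ∀ T : ℤ, 0 < T → ‖P T w'‖ ≤ 2 * (γ * ‖e'‖) + ‖e'‖ / Γ := by
    intro T hT
    have hadd : ∀ u u' : Ell2e, ‖P T (u + u')‖ ≤ ‖P T u‖ + ‖P T u'‖ := fun u u' => by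
      rw [P_add]; exact norm_add_le _ _
    have h1 := hs _ _ _ hsol T hT
    have h2 := hadd (ofL2 e') (G d)
    have h3 : ‖P T w'‖ ≤ ‖P T (w' - d)‖ + ‖P T d‖ := by simpa using hadd (w' - d) d
    have h4 := norm_P_ofL2_le T e'
    have h5 := hgain T hT d
    have h6 : ‖P T d‖ ≤ (t - s) * C * ‖P T v'‖ := by
      refine norm_P_le_of_abs_le (mul_nonneg (by linarith) hC0.le) (fun k => ?_) T
      change |(t - s) * N (v'.1 k)| ≤ _
      rw [abs_mul, abs_of_nonneg (sub_nonneg.2 hst), mul_assoc]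
      exact mul_le_mul_of_nonneg_left (hN _) (by linarith)
    have h7 : ‖P T v'‖ ≤ Γ * ‖P T w'‖ + ‖e'‖ := by
      rw [h'.linear]
      exact (hadd _ _).trans (add_le_add (hgain T hT w') h4)
    have h8 : ‖P T w'‖ ≤ γ * ‖e'‖ + (γ * Γ + 1) * ‖P T d‖ := by
      have : γ * ‖P T (ofL2 e' + G d)‖ ≤ γ * (‖e'‖ + Γ * ‖P T d‖) := by
        gcongr; linarith
      linarith
    have h9 : (γ * Γ + 1) * ‖P T d‖ ≤ (2 * Γ)⁻¹ * (Γ * ‖P T w'‖ + ‖e'‖) := by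
      have h10 : (t - s) * C * (γ * Γ + 1) ≤ (2 * Γ)⁻¹ := by
        calc (t - s) * C * (γ * Γ + 1)
            ≤ (2 * (C * (γ * Γ + 1) * Γ))⁻¹ * C * (γ * Γ + 1) := by gcongr; linarith
          _ = (2 * Γ)⁻¹ := by field_simp
      calc (γ * Γ + 1) * ‖P T d‖ ≤ (γ * Γ + 1) * ((t - s) * C * ‖P T v'‖) := by gcongr
        _ = (t - s) * C * (γ * Γ + 1) * ‖P T v'‖ := by ring
        _ ≤ (2 * Γ)⁻¹ * (Γ * ‖P T w'‖ + ‖e'‖) := by gcongr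
    have h11 : (2 * Γ)⁻¹ * (Γ * ‖P T w'‖ + ‖e'‖) = ‖P T w'‖ / 2 + ‖e'‖ / Γ / 2 := by
      field_simp
    linarith
  have hw2 : Memℓp w'.1 2 := memℓp_of_norm_P_le hbound
  let w2 : Ell2Plus := ⟨⟨w'.1, hw2⟩, mem_Ell2e_iff.1 w'.2⟩
  have hof : ofL2 w2 = w' := rfl
  let v2 : Ell2Plus := linearL2 G hb w2 + e'
  have hov : ofL2 v2 = v' := by
    rw [h'.linear]; rfl
  have h12 := hl2 e' v2 w2 (by rw [hof, hov]; exact h')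
  calc ‖P τ w‖ = ‖P τ (ofL2 w2)‖ := by rw [hof, hw']
    _ ≤ ‖w2‖ := norm_P_ofL2_le _ _
    _ ≤ γ * ‖P τ e‖ := h12

/-- The a priori bound carries over to truncations of arbitrary loop solutions, provided that the
scalar equation remains solvable along the homotopy from the zero nonlinearity to `N`. -/
theorem norm_P_le_of_homotopy (hc : IsCausal G) (hti : IsTimeInvariant G)
    (hb : IsBoundedSystem G) {γ : ℝ} (hγ : 0 < γ)
    (hl2 : ∀ (N : ℝ → ℝ) (C : ℝ), Monotone N → (∀ x, |N x| ≤ C * |x|) →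
      ∀ e v w : Ell2Plus, IsLoopSolution G N (ofL2 e) (ofL2 v) (ofL2 w) → ‖w‖ ≤ γ * ‖e‖)
    {N : ℝ → ℝ} (hN : Monotone N) {C : ℝ} (hC0 : 0 < C) (hC : ∀ x, |N x| ≤ C * |x|)
    (hsurj : ∀ s, 0 ≤ s → s ≤ 1 → Function.Surjective fun x => x - feedthrough G * (s * N x))
    {e v w : Ell2e} (h : IsLoopSolution G N e v w) {τ : ℤ} (hτ : 0 < τ) :
    ‖P τ w‖ ≤ γ * ‖P τ e‖ := by
  obtain ⟨δ, hδ, hstep⟩ := exists_homotopy_step hc hti hb hγ hC0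
  have key : ∀ n : ℕ, ∀ s, 0 ≤ s → s ≤ 1 → s ≤ n * δ →
      ∀ e v w, IsLoopSolution G (fun x => s * N x) e v w →
        ∀ τ : ℤ, 0 < τ → ‖P τ w‖ ≤ γ * ‖P τ e‖ := by
    intro n
    induction n with
    | zero =>
      intro s hs0 _ hs e v w h τ _
      have hs' : s = 0 := le_antisymm (by simpa using hs) hs0
      have hw := norm_P_le_of_abs_le (u := w) (u' := w) le_rfl
        (fun k => by rw [h.memoryless k, hs']; simp) τ
      rw [zero_mul] at hw
      exact hw.trans (by positivity)
    | succ n ih =>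
      intro s hs0 hs1 hs
      push_cast at hs
      have hms : max 0 (s - δ) ≤ s := max_le hs0 (by linarith)
      refine hstep N hC (max 0 (s - δ)) s hms (by linarith [le_max_right 0 (s - δ)])
        (hl2 _ (s * C) (hN.const_mul hs0) fun x => ?_) (hsurj s hs0 hs1)
        (ih _ (le_max_left _ _) (hms.trans hs1) (max_le (by positivity) (by linarith)))
      rw [abs_mul, abs_of_nonneg hs0, mul_assoc]
      exact mul_le_mul_of_nonneg_left (hC x) hs0
  obtain ⟨n, hn⟩ := exists_nat_ge (1 / δ)
  rw [div_le_iff₀ hδ] at hn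
  exact key n 1 zero_le_one le_rfl hn e v w (by simpa using h) τ hτ

/-! ### The feedthrough and the scalar loop equation -/

/-- If the feedthrough were positive, the linear loops `w = k v` with `0 ≤ k < 1 / feedthrough G`
would have gain at most `γ`, whereas their response at time `0` to the unit pulse,
`k / (1 - k * feedthrough G)`, is unbounded in `k`. -/
theorem feedthrough_nonpos (hc : IsCausal G) (hti : IsTimeInvariant G)
    (hb : IsBoundedSystem G) {γ : ℝ} (hγ : 0 < γ)
    (hl2 : ∀ (N : ℝ → ℝ) (C : ℝ), Monotone N → (∀ x, |N x| ≤ C * |x|) →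
      ∀ e v w : Ell2Plus, IsLoopSolution G N (ofL2 e) (ofL2 v) (ofL2 w) → ‖w‖ ≤ γ * ‖e‖) :
    feedthrough G ≤ 0 := by
  by_contra! hg
  set g := feedthrough G with hgdef
  -- The gain `k` is chosen such that `k / (1 - k * g) = γ + 1`.
  set k : ℝ := (γ + 1) / (1 + (γ + 1) * g) with hk
  have hk0 : 0 < k := by positivity
  have hkg : 1 - k * g = 1 / (1 + (γ + 1) * g) := by
    rw [hk]; field_simp; ring
  have hkg0 : 0 < 1 - k * g := by rw [hkg]; positivity
  have hsurj : ∀ s, 0 ≤ s → s ≤ 1 → Function.Surjective fun x => x - g * (s * (k * x)) := by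
    intro s hs0 hs1 y
    have : 0 < 1 - s * (k * g) := by nlinarith [mul_pos hk0 hg]
    refine ⟨y / (1 - s * (k * g)), ?_⟩
    calc _ = y / (1 - s * (k * g)) * (1 - s * (k * g)) := by ring
      _ = y := div_mul_cancel₀ y this.ne'
  have hc0 : ∀ i ≤ ((0 : ℕ) : ℤ), ((γ + 1) • pulse 0).1 i =
      k * ((G ((γ + 1) • pulse 0)).1 i + (pulse 0).1 i) := by
    intro i hi
    rcases hi.lt_or_eq with hi | rfl
    · rw [mem_Ell2e_iff.1 ((γ + 1) • pulse 0).2 i hi, mem_Ell2e_iff.1 (G _).2 i hi,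
        mem_Ell2e_iff.1 (pulse 0).2 i hi]
      simp
    · rw [map_smul]
      have h1 : (pulse 0).1 ((0 : ℕ) : ℤ) = 1 := by simp [pulse]
      change (γ + 1) * (pulse 0).1 ((0 : ℕ) : ℤ) =
        k * ((γ + 1) * g + (pulse 0).1 ((0 : ℕ) : ℤ))
      rw [h1, hk]
      field_simp
      ring
  obtain ⟨v, w, h, hw⟩ := exists_continuation hc hti (N := fun x => k * x)
    (by simpa using hsurj 1 zero_le_one le_rfl) hc0
  have hbd := norm_P_le_of_homotopy hc hti hb hγ hl2 (monotone_id.const_mul hk0.le) hk0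
    (fun x => by simp [abs_mul, abs_of_pos hk0]) hsurj h one_pos
  have he : ‖P 1 (ofL2 (P ((0 : ℕ) : ℤ) (pulse 0)))‖ ≤ 1 := by
    refine (norm_P_ofL2_le _ _).trans (le_of_eq ?_)
    have : ((P ((0 : ℕ) : ℤ) (pulse 0) : Ell2Plus) : Ell2) = lp.single 2 0 (1 : ℝ) := by
      ext i
      rw [P_apply]
      rcases eq_or_ne i 0 with rfl | hi <;> simp [pulse, *]
    change ‖((P ((0 : ℕ) : ℤ) (pulse 0) : Ell2Plus) : Ell2)‖ = 1
    rw [this, lp.norm_single (by simp), norm_one]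
  have hw0 : γ + 1 ≤ ‖P 1 w‖ := by
    have h1 := lp.norm_apply_le_norm (by simp) ((P 1 w : Ell2Plus) : Ell2) 0
    have h2 := P_eq_iff.1 hw 0 le_rfl
    have h3 : ((γ + 1) • pulse 0).1 0 = γ + 1 := by simp [pulse]
    rw [P_apply, if_pos zero_le_one, h2, h3, Real.norm_of_nonneg (by positivity)] at h1
    exact h1
  nlinarith

/-- Well-posedness makes the scalar loop equation solvable: it is the loop equation
at time `0` for the input `y` times the unit pulse. -/
theorem surjective_of_wellPosed (hc : IsCausal G) {φ : Ell2e → Ell2e}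
    {N : ℝ → ℝ} (hN : Realizes N φ) (h : WellPosed G φ) :
    Function.Surjective fun x => x - feedthrough G * N x := by
  intro y
  obtain ⟨V, W, -, -, hVW⟩ := h
  obtain ⟨h1, h2⟩ := hVW (y • pulse 0)
  refine ⟨(V (y • pulse 0)).1 0, ?_⟩
  have h3 : (W (y • pulse 0)).1 0 = N ((V (y • pulse 0)).1 0) := by
    conv_lhs => rw [h2]
    exact hN _ 0 le_rfl
  have h4 : ∀ k ≤ 0, (W (y • pulse 0)).1 k = ((W (y • pulse 0)).1 0 • pulse 0).1 k := by
    intro k hk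
    rcases hk.lt_or_eq with hk | rfl
    · rw [mem_Ell2e_iff.1 (W _).2 k hk, mem_Ell2e_iff.1 (_ • pulse 0).2 k hk]
    · simp [pulse]
  have h5 := apply_eq_of_causal hc le_rfl h4 0 le_rfl
  rw [map_smul] at h5
  change _ = (W (y • pulse 0)).1 0 * feedthrough G at h5
  have h6 : (V (y • pulse 0)).1 0 = (G (W (y • pulse 0))).1 0 + y := by
    conv_lhs => rw [h1]
    simp [pulse]
  simp only
  rw [← h3, h6, h5]
  ring

/-- For `g ≤ 0` the monotone function `x - g * N x` is continuous once it is surjective, and then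
`x - g * (s * N x)` is continuous and coercive. The function `N` itself may be discontinuous if
`g = 0`. -/
theorem surjective_sub_mul {N : ℝ → ℝ} (hN : Monotone N) {g : ℝ} (hg : g ≤ 0)
    (hsurj : Function.Surjective fun x => x - g * N x) {s : ℝ} (hs : 0 ≤ s) :
    Function.Surjective fun x => x - g * (s * N x) := by
  have hmono : ∀ t : ℝ, 0 ≤ t → Monotone fun x => x - g * (t * N x) := by
    intro t ht x y hxy
    have := mul_nonneg (mul_nonneg (neg_nonneg.2 hg) ht) (sub_nonneg.2 (hN hxy))
    simp only
    linarith
  have hcont : Continuous fun x => x - g * N x :=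
    Monotone.continuous_of_surjective (by simpa using hmono 1 zero_le_one) hsurj
  have hcont' : Continuous fun x => x - g * (s * N x) := by
    have : (fun x => x - g * (s * N x)) = fun x => x - s * (x - (x - g * N x)) := by
      ext x; ring
    rw [this]
    fun_prop
  have hgs : g * s ≤ 0 := mul_nonpos_of_nonpos_of_nonneg hg hs
  refine hcont'.surjective ?_ ?_
  · refine Filter.tendsto_atTop_mono' _ ?_
      (Filter.tendsto_atTop_add_const_right _ (-(g * (s * N 0))) Filter.tendsto_id)
    filter_upwards [Filter.eventually_ge_atTop 0] with x hx
    have := mul_le_mul_of_nonpos_left (hN hx) hgs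
    rw [id]
    linarith
  · refine Filter.tendsto_atBot_mono' _ ?_
      (Filter.tendsto_atBot_add_const_right _ (-(g * (s * N 0))) Filter.tendsto_id)
    filter_upwards [Filter.eventually_le_atBot 0] with x hx
    have := mul_le_mul_of_nonpos_left (hN hx) hgs
    rw [id]
    linarith

end Lurye

theorem mainTheorem9
    (G : Lurye.Ell2e →ₗ[ℝ] Lurye.Ell2e)
    (hTI : Lurye.IsTimeInvariant G) (hcausal : Lurye.IsCausal G)
    (hbdd : Lurye.IsBoundedSystem G)
    (𝒯 : Set (Lurye.Ell2e → Lurye.Ell2e)) (h𝒯 : 𝒯 ⊆ Lurye.MonotoneNonlinearities)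
    (hwp : ∀ φ ∈ 𝒯, Lurye.WellPosed G φ)
    (hmult : ∃ M : Lurye.Ell2 →L[ℝ] Lurye.Ell2, Lurye.IsLTVMultiplier M ∧
      ∃ (ψ : ℝ → ℤ → ℝ) (hψ : Lurye.IsSectorMultiplier ψ)
        (φ₀ : Lurye.Ell2e → Lurye.Ell2e) (hφ₀ : φ₀ ∈ Lurye.LipschitzMonotoneNonlinearities)
        (ε : ℝ), 0 < ε ∧ ∀ w : Lurye.Ell2Plus,
          inner ℝ (M (Lurye.monotoneL2 φ₀ hφ₀ (Lurye.linearL2 G hbdd w))) (w : Lurye.Ell2)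
            + inner ℝ (Lurye.sectorL2 ψ hψ (Lurye.linearL2 G hbdd w)) w
          ≤ -ε * ‖w‖ ^ 2) :
    Lurye.UniformlyRobustlyStable G 𝒯 := by
  obtain ⟨M, hM, ψ, hψ, φ₀, hφ₀, ε, hε, hineq⟩ := hmult
  obtain ⟨γ, hγ, hl2⟩ := Lurye.exists_l2_gain hbdd hM hψ hφ₀ hε hineq
  have hg := Lurye.feedthrough_nonpos hcausal hTI hbdd hγ hl2
  refine ⟨hwp, γ, hγ, fun φ hφ e v w hsol τ hτ hne => ?_⟩
  rw [div_le_iff₀ (norm_pos_iff.2 hne)]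
  obtain ⟨N, hN, ⟨C, hC0, hC⟩, hmono⟩ := h𝒯 hφ
  have hsurj := Lurye.surjective_of_wellPosed hcausal hN (hwp φ hφ)
  refine Lurye.norm_P_le_of_homotopy hcausal hTI hbdd hγ hl2 hmono hC0 hC
    (fun s hs _ => Lurye.surjective_sub_mul hmono hg hsurj hs) (v := v) ⟨hsol.1, fun k => ?_⟩ hτ
  rcases le_or_gt 0 k with hk | hk
  · rw [hsol.2]; exact hN v k hk
  · rw [Lurye.mem_Ell2e_iff.1 w.2 k hk, Lurye.mem_Ell2e_iff.1 v.2 k hk,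
      Lurye.apply_zero_of_abs_le hC]
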